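/- Let $p_n$ denote the $n$-th prime number, so that $p_1 = 2$, $p_2 = 3$, $p_3 = 5$, and so on. Then for every integer $n \geq 9$, $$p_{n+2}^3 < p_{n+1}^3 + p_n^3.$$ -/

import Mathlib

/-- The `n`-th prime number `p_n`, counted from `p_1 = 2`, for `n ≥ 1`.
Mathlib's `Nat.nth` counts from `0`, hence the shift. -/
noncomputable def nthPrime (n : ℕ) : ℕ := Nat.nth Nat.Prime (n - 1)

open Finset ArithmeticFunction Chebyshev

/-! If two primes a < b lie above p = p_n and b³ < 2p³, then p_{n+2}³ ≤ b³ < 2p³ < p_{n+1}³ + p_n³.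
Since (5/4)³ = 125/64 < 2, two primes in (n, 5n/4] suffice. For large n these come from Chebyshev's
method: his factorial ratio traps ψ(n) between An and nearly (6/5)An up to lower-order terms, with A
≈ 0.921 (`mul_sub_log_le_psi`, `psi_le_of_large`). As 6/5 < 5/4, θ(5n/4) − θ(n) exceeds log(5n/4),
more than one prime can contribute. Below 1900000 an explicit chain of primes does the job
(`primePairAbove_of_ge`); p = 23, 29, 31 are checked directly. -/

/-! ### Stirling-type bounds for log n! -/

/-- Convexity: x log x − x has derivative log x, so it lies above its tangent at a. -/
lemma sub_mul_log_le {a b : ℝ} (ha : 0 < a) (hb : 0 < b) :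
    (b - a) * Real.log a ≤ (b * Real.log b - b) - (a * Real.log a - a) := by
  have h := Real.one_sub_inv_le_log_of_pos (div_pos hb ha)
  rw [Real.log_div hb.ne' ha.ne', inv_div] at h
  have h2 := mul_le_mul_of_nonneg_left h hb.le
  have h3 : b * (1 - a / b) = b - a := by field_simp
  rw [h3] at h2
  linarith

lemma mul_log_sub_self_le_log_factorial (n : ℕ) :
    n * Real.log n - n ≤ Real.log (n.factorial) := by
  induction n with
  | zero => simp
  | succ n ih =>
    have hf : ((n.factorial : ℕ) : ℝ) ≠ 0 := by exact_mod_cast n.factorial_ne_zero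
    have h1 : ((n : ℝ) + 1) ≠ 0 := by positivity
    rw [Nat.factorial_succ]
    push_cast
    rw [Real.log_mul h1 hf]
    rcases Nat.eq_zero_or_pos n with rfl | hn
    · simp
    · have hn' : (0 : ℝ) < n := by exact_mod_cast hn
      have := sub_mul_log_le (a := (n : ℝ) + 1) (b := n) (by positivity) hn'
      linarith

lemma log_factorial_le_mul_log {n : ℕ} (hn : 1 ≤ n) :
    Real.log (n.factorial) ≤ n * Real.log n - n + Real.log n + 1 := by
  induction n, hn using Nat.le_induction with
  | base => simp
  | succ n hn ih =>
    have hf : ((n.factorial : ℕ) : ℝ) ≠ 0 := by exact_mod_cast n.factorial_ne_zero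
    have hn' : (0 : ℝ) < n := by exact_mod_cast hn
    have h1 : (0 : ℝ) < (n : ℝ) + 1 := by positivity
    rw [Nat.factorial_succ]
    push_cast
    rw [Real.log_mul h1.ne' hf]
    have h := Real.one_sub_inv_le_log_of_pos (div_pos h1 hn')
    rw [Real.log_div h1.ne' hn'.ne', inv_div] at h
    have h2 := mul_le_mul_of_nonneg_left h h1.le
    have h3 : ((n : ℝ) + 1) * (1 - n / (n + 1)) = 1 := by field_simp; ring
    rw [h3] at h2
    linarith

lemma abs_log_factorial_floor_sub_le {y : ℝ} (hy : 1 ≤ y) :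
    |Real.log (⌊y⌋₊.factorial) - (y * Real.log y - y)| ≤ Real.log y + 1 := by
  have hy0 : 0 < y := by linarith
  have hn : 1 ≤ ⌊y⌋₊ := Nat.one_le_floor_iff _ |>.2 hy
  have hn1 : (1 : ℝ) ≤ (⌊y⌋₊ : ℝ) := by exact_mod_cast hn
  have hny : (⌊y⌋₊ : ℝ) ≤ y := Nat.floor_le hy0.le
  have hyn : y < ⌊y⌋₊ + 1 := Nat.lt_floor_add_one y
  have hlogn : 0 ≤ Real.log (⌊y⌋₊ : ℝ) := Real.log_nonneg hn1
  have hlogy : 0 ≤ Real.log y := Real.log_nonneg hy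
  have hlog : Real.log (⌊y⌋₊ : ℝ) ≤ Real.log y := Real.log_le_log (by linarith) hny
  rw [abs_le]
  constructor
  -- The bound is taken at ⌊y⌋ + 1 > y; the extra factor costs log(⌊y⌋ + 1) ≤ log(2y) ≤ log y + 1.
  · have h1 := mul_log_sub_self_le_log_factorial (⌊y⌋₊ + 1)
    have hf : ((⌊y⌋₊.factorial : ℕ) : ℝ) ≠ 0 := by exact_mod_cast Nat.factorial_ne_zero _
    rw [Nat.factorial_succ] at h1
    push_cast at h1
    rw [Real.log_mul (by positivity) hf] at h1
    have h2 := sub_mul_log_le (a := y) (b := (⌊y⌋₊ : ℝ) + 1) hy0 (by positivity)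
    have h3 : Real.log ((⌊y⌋₊ : ℝ) + 1) ≤ Real.log y + 1 := by
      have h4 : Real.log ((⌊y⌋₊ : ℝ) + 1) ≤ Real.log (2 * y) :=
        Real.log_le_log (by positivity) (by linarith)
      rw [Real.log_mul (by norm_num) hy0.ne'] at h4
      linarith [Real.log_two_lt_d9]
    nlinarith [mul_nonneg (sub_nonneg.2 hyn.le) hlogy]
  · have h1 := log_factorial_le_mul_log hn
    have h2 := sub_mul_log_le (a := (⌊y⌋₊ : ℝ)) (b := y) (by linarith) hy0
    nlinarith [mul_nonneg (sub_nonneg.2 hny) hlogn]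

/-! ### Chebyshev's factorial ratio and the von Mangoldt function -/

lemma log_factorial_eq_sum_vonMangoldt (n : ℕ) :
    Real.log (n.factorial) = ∑ d ∈ Ioc 0 n, Λ d * ((n / d : ℕ) : ℝ) := by
  induction n with
  | zero => simp
  | succ n ih =>
    have hf : ((n.factorial : ℕ) : ℝ) ≠ 0 := by exact_mod_cast n.factorial_ne_zero
    have h1 : ((n : ℝ) + 1) ≠ 0 := by positivity
    have hdiv : ∑ d ∈ Ioc 0 (n + 1), (if d ∣ n + 1 then Λ d else 0) = Real.log (n + 1) := by
      rw [← sum_filter]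
      have : (Ioc 0 (n + 1)).filter (· ∣ n + 1) = (n + 1).divisors := by
        ext d
        simp only [mem_filter, mem_Ioc, Nat.mem_divisors]
        constructor
        · rintro ⟨-, h⟩; exact ⟨h, by omega⟩
        · rintro ⟨h, -⟩; exact ⟨⟨Nat.pos_of_dvd_of_pos h (by omega), Nat.le_of_dvd (by omega) h⟩, h⟩
      rw [this, vonMangoldt_sum]
      push_cast; rfl
    have hext : ∑ d ∈ Ioc 0 (n + 1), Λ d * ((n / d : ℕ) : ℝ)
        = ∑ d ∈ Ioc 0 n, Λ d * ((n / d : ℕ) : ℝ) := by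
      rw [sum_Ioc_succ_top (by omega), Nat.div_eq_of_lt (Nat.lt_succ_self n)]
      simp
    rw [Nat.factorial_succ]
    push_cast
    rw [Real.log_mul h1 hf, ih, ← hdiv, ← hext, ← sum_add_distrib]
    refine sum_congr rfl fun d _ => ?_
    rw [Nat.succ_div]
    split_ifs <;> push_cast <;> ring

lemma log_factorial_div_eq_sum_vonMangoldt (n k : ℕ) :
    Real.log ((n / k).factorial) = ∑ d ∈ Ioc 0 n, Λ d * ((n / d / k : ℕ) : ℝ) := by
  rw [log_factorial_eq_sum_vonMangoldt]
  have hsub : Ioc 0 (n / k) ⊆ Ioc 0 n := Ioc_subset_Ioc_right (Nat.div_le_self n k)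
  rw [sum_congr rfl fun d _ => by rw [Nat.div_div_eq_div_mul, mul_comm k d, ← Nat.div_div_eq_div_mul]]
  refine sum_subset hsub fun d hd hd' => ?_
  simp only [mem_Ioc, not_and, not_le] at hd hd'
  rw [Nat.div_div_eq_div_mul, mul_comm d k, ← Nat.div_div_eq_div_mul,
    Nat.div_eq_of_lt (hd' hd.1)]
  simp

/-- The logarithm of Chebyshev's factorial ratio `n! ⌊n/30⌋! / (⌊n/2⌋! ⌊n/3⌋! ⌊n/5⌋!)`. -/
noncomputable def logChebyshevRatio (n : ℕ) : ℝ :=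
  Real.log (n.factorial) - Real.log ((n / 2).factorial) - Real.log ((n / 3).factorial)
    - Real.log ((n / 5).factorial) + Real.log ((n / 30).factorial)

lemma logChebyshevRatio_eq_sum (n : ℕ) :
    logChebyshevRatio n = ∑ d ∈ Ioc 0 n, Λ d *
      (((n / d : ℕ) : ℝ) - ((n / d / 2 : ℕ) : ℝ) - ((n / d / 3 : ℕ) : ℝ) - ((n / d / 5 : ℕ) : ℝ)
        + ((n / d / 30 : ℕ) : ℝ)) := by
  simp only [mul_add, mul_sub, sum_add_distrib, sum_sub_distrib,
    ← log_factorial_div_eq_sum_vonMangoldt, ← log_factorial_eq_sum_vonMangoldt]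
  rfl

/-- Each coefficient of Λ(d) is at most 1. -/
lemma logChebyshevRatio_le_psi (n : ℕ) : logChebyshevRatio n ≤ ψ n := by
  rw [logChebyshevRatio_eq_sum, psi, Nat.floor_natCast]
  refine sum_le_sum fun d _ => mul_le_of_le_one_right vonMangoldt_nonneg ?_
  have : n / d + n / d / 30 ≤ 1 + n / d / 2 + n / d / 3 + n / d / 5 := by omega
  have h : ((n / d : ℕ) : ℝ) + ((n / d / 30 : ℕ) : ℝ)
      ≤ 1 + ((n / d / 2 : ℕ) : ℝ) + ((n / d / 3 : ℕ) : ℝ) + ((n / d / 5 : ℕ) : ℝ) := by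
    exact_mod_cast this
  linarith

/-- Every coefficient is nonnegative, and it is at least 1 when d > n/6, where 1 ≤ ⌊n/d⌋ ≤ 5. -/
lemma psi_sub_psi_div_six_le (n : ℕ) : ψ n - ψ ((n / 6 : ℕ) : ℝ) ≤ logChebyshevRatio n := by
  rw [logChebyshevRatio_eq_sum, psi, psi, Nat.floor_natCast, Nat.floor_natCast]
  have hsub : Ioc 0 (n / 6) ⊆ Ioc 0 n := Ioc_subset_Ioc_right (Nat.div_le_self n 6)
  rw [← sum_sdiff hsub, add_sub_cancel_right, ← sum_sdiff hsub]
  have key : ∀ m : ℕ, m / 2 + m / 3 + m / 5 ≤ m + m / 30 := by omega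
  have key' : ∀ m : ℕ, 1 ≤ m → m < 6 → m / 2 + m / 3 + m / 5 + 1 ≤ m + m / 30 := by omega
  refine le_add_of_le_of_nonneg (sum_le_sum fun d hd => ?_) (sum_nonneg fun d _ => ?_)
  · refine le_mul_of_one_le_right vonMangoldt_nonneg ?_
    simp only [mem_sdiff, mem_Ioc, not_and, not_le] at hd
    have h1 : 1 ≤ n / d := (Nat.one_le_div_iff hd.1.1).2 hd.1.2
    have h2 : n / d < 6 := by
      rw [Nat.div_lt_iff_lt_mul hd.1.1]
      have := hd.2 hd.1.1
      omega
    have h : ((n / d / 2 : ℕ) : ℝ) + ((n / d / 3 : ℕ) : ℝ) + ((n / d / 5 : ℕ) : ℝ) + 1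
        ≤ ((n / d : ℕ) : ℝ) + ((n / d / 30 : ℕ) : ℝ) := by exact_mod_cast key' _ h1 h2
    linarith
  · refine mul_nonneg vonMangoldt_nonneg ?_
    have h : ((n / d / 2 : ℕ) : ℝ) + ((n / d / 3 : ℕ) : ℝ) + ((n / d / 5 : ℕ) : ℝ)
        ≤ ((n / d : ℕ) : ℝ) + ((n / d / 30 : ℕ) : ℝ) := by exact_mod_cast key (n / d)
    linarith

/-- Chebyshev's constant `0.92129…`. -/
noncomputable def chebyshevConst : ℝ :=
  Real.log 2 / 2 + Real.log 3 / 3 + Real.log 5 / 5 - Real.log 30 / 30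

lemma chebyshevConst_bounds : 0.921 < chebyshevConst ∧ chebyshevConst < 0.922 := by
  have h30 : Real.log 30 = Real.log 2 + Real.log 3 + Real.log 5 := by
    rw [← Real.log_mul (by norm_num) (by norm_num), ← Real.log_mul (by norm_num) (by norm_num)]
    norm_num
  unfold chebyshevConst
  rw [h30]
  constructor <;> linarith [Real.log_two_gt_d9, Real.log_two_lt_d9, Real.log_three_gt_d9,
    Real.log_three_lt_d9, Real.log_five_gt_d9, Real.log_five_lt_d9]

/-- As 1 − 1/2 − 1/3 − 1/5 + 1/30 = 0, the n log n and −n terms cancel; each of the five factorials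
contributes an error of at most log n + 1. -/
lemma abs_logChebyshevRatio_sub_le {n : ℕ} (hn : 30 ≤ n) :
    |logChebyshevRatio n - chebyshevConst * n| ≤ 5 * Real.log n + 5 := by
  have hx : (30 : ℝ) ≤ n := by exact_mod_cast hn
  have bound : ∀ k : ℕ, 1 ≤ k → k ≤ 30 →
      |Real.log ((n / k).factorial)
        - ((n : ℝ) / k * (Real.log n - Real.log k) - (n : ℝ) / k)| ≤ Real.log n + 1 := by
    intro k hk1 hk
    have hk1' : (1 : ℝ) ≤ k := by exact_mod_cast hk1
    have hk' : (k : ℝ) ≤ 30 := by exact_mod_cast hk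
    have h := abs_log_factorial_floor_sub_le (y := (n : ℝ) / k)
      (by rw [one_le_div (by linarith)]; linarith)
    rw [Nat.floor_div_natCast, Nat.floor_natCast, Real.log_div (by linarith) (by linarith)] at h
    linarith [Real.log_nonneg hk1']
  have b1 := abs_le.1 (bound 1 (by norm_num) (by norm_num))
  have b2 := abs_le.1 (bound 2 (by norm_num) (by norm_num))
  have b3 := abs_le.1 (bound 3 (by norm_num) (by norm_num))
  have b5 := abs_le.1 (bound 5 (by norm_num) (by norm_num))
  have b30 := abs_le.1 (bound 30 (by norm_num) (by norm_num))
  simp only [Nat.div_one, Nat.cast_one, Nat.cast_ofNat, Real.log_one, div_one, sub_zero]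
    at b1 b2 b3 b5 b30
  unfold logChebyshevRatio chebyshevConst
  rw [abs_le]
  constructor <;> linarith

/-! ### Explicit Chebyshev bounds for ψ -/

lemma mul_sub_log_le_psi {n : ℕ} (hn : 30 ≤ n) :
    chebyshevConst * n - (5 * Real.log n + 5) ≤ ψ n := by
  have h := (abs_le.1 (abs_logChebyshevRatio_sub_le hn)).1
  linarith [logChebyshevRatio_le_psi n]

lemma psi_le_psi_div_six_add {n : ℕ} (hn : 30 ≤ n) :
    ψ n ≤ ψ ((n / 6 : ℕ) : ℝ) + chebyshevConst * n + (5 * Real.log n + 5) := by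
  have h := (abs_le.1 (abs_logChebyshevRatio_sub_le hn)).2
  linarith [psi_sub_psi_div_six_le n]

/-- Four descents n → n/6 give 1 + 1/6 + 1/36 + 1/216 = 259/216; the remaining ψ(n/1296) is bounded
crudely, with log 4 + 4 < 5.4. -/
lemma psi_le_of_large {n : ℕ} (hn : 40000 ≤ n) :
    ψ n ≤ chebyshevConst * (259 / 216) * n + 5.4 / 1296 * n + 20 * Real.log n + 20 := by
  have hC := chebyshevConst_bounds.1
  have step : ∀ k : ℕ, 1 ≤ k → k ≤ 216 →
      ψ ((n / k : ℕ) : ℝ) ≤ ψ ((n / (k * 6) : ℕ) : ℝ) + chebyshevConst * (n / k)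
        + (5 * Real.log n + 5) := by
    intro k hk1 hk
    have hk0 : 0 < k := hk1
    have h30 : 30 ≤ n / k := by
      rw [Nat.le_div_iff_mul_le hk0]; omega
    have h := psi_le_psi_div_six_add h30
    rw [Nat.div_div_eq_div_mul] at h
    have h1 : ((n / k : ℕ) : ℝ) ≤ (n : ℝ) / k := Nat.cast_div_le
    have h2 : Real.log ((n / k : ℕ) : ℝ) ≤ Real.log n :=
      Real.log_le_log (by exact_mod_cast (by omega : 0 < n / k))
        (by exact_mod_cast Nat.div_le_self n k)
    have h3 := mul_le_mul_of_nonneg_left h1 (by linarith : 0 ≤ chebyshevConst)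
    linarith
  have s1 := step 1 (by norm_num) (by norm_num)
  have s2 := step 6 (by norm_num) (by norm_num)
  have s3 := step 36 (by norm_num) (by norm_num)
  have s4 := step 216 (by norm_num) (by norm_num)
  norm_num at s1 s2 s3 s4
  have h1 : ((n / 1296 : ℕ) : ℝ) ≤ (n : ℝ) / 1296 := by
    exact_mod_cast (Nat.cast_div_le : ((n / 1296 : ℕ) : ℝ) ≤ (n : ℝ) / (1296 : ℕ))
  have h2 := psi_le_const_mul_self (x := ((n / 1296 : ℕ) : ℝ)) (by positivity)
  have h4 : Real.log 4 = 2 * Real.log 2 := by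
    rw [show (4 : ℝ) = 2 ^ 2 by norm_num, Real.log_pow]; norm_num
  have h5 : (Real.log 4 + 4) * ((n / 1296 : ℕ) : ℝ) ≤ 5.4 * ((n : ℝ) / 1296) :=
    mul_le_mul (by linarith [Real.log_two_lt_d9]) h1 (by positivity) (by norm_num)
  linarith

/-! ### Two primes in (n, 5n/4] for large n -/

lemma log_le_quarter_power {t : ℝ} (ht : 0 < t) : Real.log (t ^ 4) ≤ t / 8 + 9.87 := by
  -- Tangent to log at 32, near the threshold t = 39 used below.
  have h := Real.log_le_sub_one_of_pos (show 0 < t / 32 by positivity)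
  have h32 : Real.log 32 = 5 * Real.log 2 := by
    rw [show (32 : ℝ) = 2 ^ 5 by norm_num, Real.log_pow]; norm_num
  rw [Real.log_div ht.ne' (by norm_num), h32] at h
  rw [Real.log_pow]
  push_cast
  linarith [Real.log_two_lt_d9]

/-- With y = 5n/4, the main terms leave 0.921(1 − (4/5)(259/216)) − (4/5)(5.4/1296) > 0.0341 per
unit of y. The logarithms number 5 + 20 + 1 = 26, and √y log y comes from ψ − θ. -/
lemma error_terms_lt {y : ℝ} (hy : 39 ^ 4 ≤ y) :
    2 * √y * Real.log y + 26 * Real.log y + 26 < 0.0341 * y := by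
  obtain ⟨t, ht, rfl⟩ : ∃ t : ℝ, 39 ≤ t ∧ y = t ^ 4 := by
    refine ⟨√(√y), ?_, ?_⟩
    · refine Real.le_sqrt_of_sq_le (Real.le_sqrt_of_sq_le ?_)
      linarith
    · rw [show 4 = 2 * 2 by norm_num, pow_mul, Real.sq_sqrt (Real.sqrt_nonneg _),
        Real.sq_sqrt (by linarith)]
  have hs : √(t ^ 4) = t ^ 2 := by
    rw [show t ^ 4 = (t ^ 2) ^ 2 by ring, Real.sqrt_sq (by positivity)]
  have hl := log_le_quarter_power (show 0 < t by linarith)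
  rw [hs]
  have h1 := mul_le_mul_of_nonneg_left hl (show 0 ≤ 2 * t ^ 2 + 26 by positivity)
  have h2 : (2 * t ^ 2 + 26) * (t / 8 + 9.87) + 26 < 0.0341 * t ^ 4 := by
    -- After recentring at 39, the difference of the two sides has only positive coefficients in s.
    obtain ⟨s, hs0, rfl⟩ : ∃ s : ℝ, 0 ≤ s ∧ t = s + 39 := ⟨t - 39, by linarith, by ring⟩
    ring_nf
    nlinarith [pow_nonneg hs0 2, pow_nonneg hs0 3, pow_nonneg hs0 4]
  linarith

lemma log_lt_theta_sub_theta {n : ℕ} (hn : 1900000 ≤ n) :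
    Real.log ((5 * n / 4 : ℕ) : ℝ) < θ ((5 * n / 4 : ℕ) : ℝ) - θ n := by
  obtain ⟨m, hm⟩ : ∃ m, m = 5 * n / 4 := ⟨_, rfl⟩
  rw [← hm]
  have hnR : (1900000 : ℝ) ≤ n := by exact_mod_cast hn
  have hm1 : (m : ℝ) ≤ 5 / 4 * n := by
    have : ((4 * m : ℕ) : ℝ) ≤ ((5 * n : ℕ) : ℝ) := by exact_mod_cast (by omega : 4 * m ≤ 5 * n)
    push_cast at this; linarith
  have hm2 : 5 / 4 * (n : ℝ) - 1 ≤ m := by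
    have : ((5 * n : ℕ) : ℝ) ≤ ((4 * m + 4 : ℕ) : ℝ) := by
      exact_mod_cast (by omega : 5 * n ≤ 4 * m + 4)
    push_cast at this; linarith
  have hlow := mul_sub_log_le_psi (show 30 ≤ m by omega)
  have hθm := psi_sub_theta_le (x := (m : ℝ)) (by linarith)
  have hθn := theta_le_psi (n : ℝ)
  have hup := psi_le_of_large (show 40000 ≤ n by omega)
  obtain ⟨hC1, hC2⟩ := chebyshevConst_bounds
  have herr := error_terms_lt (y := 5 / 4 * (n : ℝ)) (by linarith)
  set L := Real.log (5 / 4 * (n : ℝ)) with hL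
  have hlm : Real.log m ≤ L := Real.log_le_log (by linarith) hm1
  have hln : Real.log n ≤ L := Real.log_le_log (by linarith) (by linarith)
  have hlm0 : 0 ≤ Real.log m := Real.log_nonneg (by linarith)
  have hsq : 2 * √(m : ℝ) * Real.log m ≤ 2 * √(5 / 4 * (n : ℝ)) * L := by gcongr
  have h1 := mul_le_mul_of_nonneg_left hm2 (by linarith : 0 ≤ chebyshevConst)
  nlinarith [mul_le_mul_of_nonneg_right hC1.le (by linarith : (0 : ℝ) ≤ n)]

/-- There are two primes above `n` whose cubes stay below `2 * n ^ 3`. -/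
def PrimePairAbove (n : ℕ) : Prop :=
  ∃ a b : ℕ, a.Prime ∧ b.Prime ∧ n < a ∧ a < b ∧ b ^ 3 < 2 * n ^ 3

/-- A single prime in (n, m] contributes at most log m to θ(m) − θ(n). -/
lemma exists_two_primes_of_log_lt {n m : ℕ} (hnm : n ≤ m) (h : Real.log m < θ m - θ n) :
    ∃ a b : ℕ, a.Prime ∧ b.Prime ∧ n < a ∧ a < b ∧ b ≤ m := by
  have hsum : θ m - θ n = ∑ p ∈ (Ioc n m).filter Nat.Prime, Real.log p := by
    rw [theta, theta, Nat.floor_natCast, Nat.floor_natCast, sum_filter, sum_filter, sum_filter,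
      ← sum_Ioc_consecutive _ (Nat.zero_le n) hnm, add_sub_cancel_left]
  have hcard : 1 < ((Ioc n m).filter Nat.Prime).card := by
    by_contra! hc
    have hle : ∑ p ∈ (Ioc n m).filter Nat.Prime, Real.log p
        ≤ ((Ioc n m).filter Nat.Prime).card • Real.log m := by
      refine sum_le_card_nsmul _ _ _ fun p hp => ?_
      simp only [mem_filter, mem_Ioc] at hp
      exact Real.log_le_log (by exact_mod_cast hp.2.pos) (by exact_mod_cast hp.1.2)
    rw [nsmul_eq_mul] at hle
    have hc' : (((Ioc n m).filter Nat.Prime).card : ℝ) ≤ 1 := by exact_mod_cast hc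
    have := mul_le_mul_of_nonneg_right hc' (Real.log_natCast_nonneg m)
    linarith
  obtain ⟨a, ha, b, hb, hab⟩ := one_lt_card.1 hcard
  simp only [mem_filter, mem_Ioc] at ha hb
  rcases lt_or_gt_of_ne hab with hlt | hlt
  · exact ⟨a, b, ha.2, hb.2, ha.1.1, hlt, hb.1.2⟩
  · exact ⟨b, a, hb.2, ha.2, hb.1.1, hlt, ha.1.2⟩

lemma primePairAbove_of_large {n : ℕ} (hn : 1900000 ≤ n) : PrimePairAbove n := by
  obtain ⟨a, b, ha, hb, hna, hab, hbm⟩ :=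
    exists_two_primes_of_log_lt (by omega) (log_lt_theta_sub_theta hn)
  refine ⟨a, b, ha, hb, hna, hab, ?_⟩
  have h1 : 4 * b ≤ 5 * n := by omega
  have h2 : (4 * b) ^ 3 ≤ (5 * n) ^ 3 := Nat.pow_le_pow_left h1 3
  have h3 : 0 < n ^ 3 := by positivity
  rw [mul_pow, mul_pow] at h2
  omega

/-! ### A chain of primes down to 37 -/

/-- For a ≤ n < b the pair (b, c) serves, since c³ < 2a³ ≤ 2n³. -/
lemma primePairAbove_step (a b c : ℕ) (hb : b.Prime) (hc : c.Prime) (hbc : b < c)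
    (hac : c ^ 3 < 2 * a ^ 3) (h : ∀ n, b ≤ n → PrimePairAbove n) :
    ∀ n, a ≤ n → PrimePairAbove n := by
  intro n hn
  rcases le_or_gt b n with hbn | hbn
  · exact h n hbn
  · exact ⟨b, c, hb, hc, hbn, hbc, hac.trans_le (by gcongr)⟩

lemma primePairAbove_of_ge : ∀ n, 37 ≤ n → PrimePairAbove n := by
  refine primePairAbove_step 37 41 43 (by norm_num) (by norm_num) (by norm_num) (by norm_num) ?_
  refine primePairAbove_step 41 43 47 (by norm_num) (by norm_num) (by norm_num) (by norm_num) ?_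
  refine primePairAbove_step 43 47 53 (by norm_num) (by norm_num) (by norm_num) (by norm_num) ?_
  refine primePairAbove_step 47 53 59 (by norm_num) (by norm_num) (by norm_num) (by norm_num) ?_
  refine primePairAbove_step 53 59 61 (by norm_num) (by norm_num) (by norm_num) (by norm_num) ?_
  refine primePairAbove_step 59 61 67 (by norm_num) (by norm_num) (by norm_num) (by norm_num) ?_
  refine primePairAbove_step 61 67 73 (by norm_num) (by norm_num) (by norm_num) (by norm_num) ?_
  refine primePairAbove_step 67 73 79 (by norm_num) (by norm_num) (by norm_num) (by norm_num) ?_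
  refine primePairAbove_step 73 79 83 (by norm_num) (by norm_num) (by norm_num) (by norm_num) ?_
  refine primePairAbove_step 79 83 89 (by norm_num) (by norm_num) (by norm_num) (by norm_num) ?_
  refine primePairAbove_step 83 89 97 (by norm_num) (by norm_num) (by norm_num) (by norm_num) ?_
  refine primePairAbove_step 89 97 107 (by norm_num) (by norm_num) (by norm_num) (by norm_num) ?_
  refine primePairAbove_step 97 107 113 (by norm_num) (by norm_num) (by norm_num) (by norm_num) ?_
  refine primePairAbove_step 107 113 127 (by norm_num) (by norm_num) (by norm_num) (by norm_num) ?_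
  refine primePairAbove_step 113 127 139 (by norm_num) (by norm_num) (by norm_num) (by norm_num) ?_
  refine primePairAbove_step 127 139 151 (by norm_num) (by norm_num) (by norm_num) (by norm_num) ?_
  refine primePairAbove_step 139 151 167 (by norm_num) (by norm_num) (by norm_num) (by norm_num) ?_
  refine primePairAbove_step 151 167 181 (by norm_num) (by norm_num) (by norm_num) (by norm_num) ?_
  refine primePairAbove_step 167 181 199 (by norm_num) (by norm_num) (by norm_num) (by norm_num) ?_
  refine primePairAbove_step 181 199 223 (by norm_num) (by norm_num) (by norm_num) (by norm_num) ?_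
  refine primePairAbove_step 199 223 241 (by norm_num) (by norm_num) (by norm_num) (by norm_num) ?_
  refine primePairAbove_step 223 241 269 (by norm_num) (by norm_num) (by norm_num) (by norm_num) ?_
  refine primePairAbove_step 241 269 293 (by norm_num) (by norm_num) (by norm_num) (by norm_num) ?_
  refine primePairAbove_step 269 293 317 (by norm_num) (by norm_num) (by norm_num) (by norm_num) ?_
  refine primePairAbove_step 293 317 353 (by norm_num) (by norm_num) (by norm_num) (by norm_num) ?_
  refine primePairAbove_step 317 353 389 (by norm_num) (by norm_num) (by norm_num) (by norm_num) ?_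
  refine primePairAbove_step 353 389 433 (by norm_num) (by norm_num) (by norm_num) (by norm_num) ?_
  refine primePairAbove_step 389 433 479 (by norm_num) (by norm_num) (by norm_num) (by norm_num) ?_
  refine primePairAbove_step 433 479 523 (by norm_num) (by norm_num) (by norm_num) (by norm_num) ?_
  refine primePairAbove_step 479 523 587 (by norm_num) (by norm_num) (by norm_num) (by norm_num) ?_
  refine primePairAbove_step 523 587 653 (by norm_num) (by norm_num) (by norm_num) (by norm_num) ?_
  refine primePairAbove_step 587 653 727 (by norm_num) (by norm_num) (by norm_num) (by norm_num) ?_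
  refine primePairAbove_step 653 727 811 (by norm_num) (by norm_num) (by norm_num) (by norm_num) ?_
  refine primePairAbove_step 727 811 907 (by norm_num) (by norm_num) (by norm_num) (by norm_num) ?_
  refine primePairAbove_step 811 907 1013 (by norm_num) (by norm_num) (by norm_num) (by norm_num) ?_
  refine primePairAbove_step 907 1013 1129 (by norm_num) (by norm_num) (by norm_num) (by norm_num) ?_
  refine primePairAbove_step 1013 1129 1259 (by norm_num) (by norm_num) (by norm_num) (by norm_num) ?_
  refine primePairAbove_step 1129 1259 1409 (by norm_num) (by norm_num) (by norm_num) (by norm_num) ?_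
  refine primePairAbove_step 1259 1409 1579 (by norm_num) (by norm_num) (by norm_num) (by norm_num) ?_
  refine primePairAbove_step 1409 1579 1759 (by norm_num) (by norm_num) (by norm_num) (by norm_num) ?_
  refine primePairAbove_step 1579 1759 1973 (by norm_num) (by norm_num) (by norm_num) (by norm_num) ?_
  refine primePairAbove_step 1759 1973 2213 (by norm_num) (by norm_num) (by norm_num) (by norm_num) ?_
  refine primePairAbove_step 1973 2213 2477 (by norm_num) (by norm_num) (by norm_num) (by norm_num) ?_
  refine primePairAbove_step 2213 2477 2777 (by norm_num) (by norm_num) (by norm_num) (by norm_num) ?_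
  refine primePairAbove_step 2477 2777 3109 (by norm_num) (by norm_num) (by norm_num) (by norm_num) ?_
  refine primePairAbove_step 2777 3109 3469 (by norm_num) (by norm_num) (by norm_num) (by norm_num) ?_
  refine primePairAbove_step 3109 3469 3889 (by norm_num) (by norm_num) (by norm_num) (by norm_num) ?_
  refine primePairAbove_step 3469 3889 4363 (by norm_num) (by norm_num) (by norm_num) (by norm_num) ?_
  refine primePairAbove_step 3889 4363 4889 (by norm_num) (by norm_num) (by norm_num) (by norm_num) ?_
  refine primePairAbove_step 4363 4889 5483 (by norm_num) (by norm_num) (by norm_num) (by norm_num) ?_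
  refine primePairAbove_step 4889 5483 6151 (by norm_num) (by norm_num) (by norm_num) (by norm_num) ?_
  refine primePairAbove_step 5483 6151 6899 (by norm_num) (by norm_num) (by norm_num) (by norm_num) ?_
  refine primePairAbove_step 6151 6899 7741 (by norm_num) (by norm_num) (by norm_num) (by norm_num) ?_
  refine primePairAbove_step 6899 7741 8689 (by norm_num) (by norm_num) (by norm_num) (by norm_num) ?_
  refine primePairAbove_step 7741 8689 9749 (by norm_num) (by norm_num) (by norm_num) (by norm_num) ?_
  refine primePairAbove_step 8689 9749 10939 (by norm_num) (by norm_num) (by norm_num) (by norm_num) ?_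
  refine primePairAbove_step 9749 10939 12277 (by norm_num) (by norm_num) (by norm_num) (by norm_num) ?_
  refine primePairAbove_step 10939 12277 13763 (by norm_num) (by norm_num) (by norm_num) (by norm_num) ?_
  refine primePairAbove_step 12277 13763 15443 (by norm_num) (by norm_num) (by norm_num) (by norm_num) ?_
  refine primePairAbove_step 13763 15443 17333 (by norm_num) (by norm_num) (by norm_num) (by norm_num) ?_
  refine primePairAbove_step 15443 17333 19447 (by norm_num) (by norm_num) (by norm_num) (by norm_num) ?_
  refine primePairAbove_step 17333 19447 21821 (by norm_num) (by norm_num) (by norm_num) (by norm_num) ?_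
  refine primePairAbove_step 19447 21821 24481 (by norm_num) (by norm_num) (by norm_num) (by norm_num) ?_
  refine primePairAbove_step 21821 24481 27479 (by norm_num) (by norm_num) (by norm_num) (by norm_num) ?_
  refine primePairAbove_step 24481 27479 30841 (by norm_num) (by norm_num) (by norm_num) (by norm_num) ?_
  refine primePairAbove_step 27479 30841 34613 (by norm_num) (by norm_num) (by norm_num) (by norm_num) ?_
  refine primePairAbove_step 30841 34613 38851 (by norm_num) (by norm_num) (by norm_num) (by norm_num) ?_
  refine primePairAbove_step 34613 38851 43609 (by norm_num) (by norm_num) (by norm_num) (by norm_num) ?_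
  refine primePairAbove_step 38851 43609 48947 (by norm_num) (by norm_num) (by norm_num) (by norm_num) ?_
  refine primePairAbove_step 43609 48947 54941 (by norm_num) (by norm_num) (by norm_num) (by norm_num) ?_
  refine primePairAbove_step 48947 54941 61667 (by norm_num) (by norm_num) (by norm_num) (by norm_num) ?_
  refine primePairAbove_step 54941 61667 69221 (by norm_num) (by norm_num) (by norm_num) (by norm_num) ?_
  refine primePairAbove_step 61667 69221 77689 (by norm_num) (by norm_num) (by norm_num) (by norm_num) ?_
  refine primePairAbove_step 69221 77689 87187 (by norm_num) (by norm_num) (by norm_num) (by norm_num) ?_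
  refine primePairAbove_step 77689 87187 97861 (by norm_num) (by norm_num) (by norm_num) (by norm_num) ?_
  refine primePairAbove_step 87187 97861 109847 (by norm_num) (by norm_num) (by norm_num) (by norm_num) ?_
  refine primePairAbove_step 97861 109847 123289 (by norm_num) (by norm_num) (by norm_num) (by norm_num) ?_
  refine primePairAbove_step 109847 123289 138389 (by norm_num) (by norm_num) (by norm_num) (by norm_num) ?_
  refine primePairAbove_step 123289 138389 155333 (by norm_num) (by norm_num) (by norm_num) (by norm_num) ?_
  refine primePairAbove_step 138389 155333 174347 (by norm_num) (by norm_num) (by norm_num) (by norm_num) ?_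
  refine primePairAbove_step 155333 174347 195697 (by norm_num) (by norm_num) (by norm_num) (by norm_num) ?_
  refine primePairAbove_step 174347 195697 219649 (by norm_num) (by norm_num) (by norm_num) (by norm_num) ?_
  refine primePairAbove_step 195697 219649 246539 (by norm_num) (by norm_num) (by norm_num) (by norm_num) ?_
  refine primePairAbove_step 219649 246539 276739 (by norm_num) (by norm_num) (by norm_num) (by norm_num) ?_
  refine primePairAbove_step 246539 276739 310591 (by norm_num) (by norm_num) (by norm_num) (by norm_num) ?_
  refine primePairAbove_step 276739 310591 348637 (by norm_num) (by norm_num) (by norm_num) (by norm_num) ?_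
  refine primePairAbove_step 310591 348637 391301 (by norm_num) (by norm_num) (by norm_num) (by norm_num) ?_
  refine primePairAbove_step 348637 391301 439217 (by norm_num) (by norm_num) (by norm_num) (by norm_num) ?_
  refine primePairAbove_step 391301 439217 493001 (by norm_num) (by norm_num) (by norm_num) (by norm_num) ?_
  refine primePairAbove_step 439217 493001 553369 (by norm_num) (by norm_num) (by norm_num) (by norm_num) ?_
  refine primePairAbove_step 493001 553369 621139 (by norm_num) (by norm_num) (by norm_num) (by norm_num) ?_
  refine primePairAbove_step 553369 621139 697201 (by norm_num) (by norm_num) (by norm_num) (by norm_num) ?_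
  refine primePairAbove_step 621139 697201 782581 (by norm_num) (by norm_num) (by norm_num) (by norm_num) ?_
  refine primePairAbove_step 697201 782581 878413 (by norm_num) (by norm_num) (by norm_num) (by norm_num) ?_
  refine primePairAbove_step 782581 878413 985981 (by norm_num) (by norm_num) (by norm_num) (by norm_num) ?_
  refine primePairAbove_step 878413 985981 1106689 (by norm_num) (by norm_num) (by norm_num) (by norm_num) ?_
  refine primePairAbove_step 985981 1106689 1242251 (by norm_num) (by norm_num) (by norm_num) (by norm_num) ?_
  refine primePairAbove_step 1106689 1242251 1394321 (by norm_num) (by norm_num) (by norm_num) (by norm_num) ?_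
  refine primePairAbove_step 1242251 1394321 1565117 (by norm_num) (by norm_num) (by norm_num) (by norm_num) ?_
  refine primePairAbove_step 1394321 1565117 1756709 (by norm_num) (by norm_num) (by norm_num) (by norm_num) ?_
  refine primePairAbove_step 1565117 1756709 1971901 (by norm_num) (by norm_num) (by norm_num) (by norm_num) ?_
  refine primePairAbove_step 1756709 1971901 2213311 (by norm_num) (by norm_num) (by norm_num) (by norm_num) ?_
  exact fun n hn => primePairAbove_of_large (by omega)

/-! ### Consecutive primes -/

lemma nth_prime_succ_le {k a : ℕ} (ha : a.Prime) (h : Nat.nth Nat.Prime k < a) :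
    Nat.nth Nat.Prime (k + 1) ≤ a := by
  by_contra! hc
  exact h.not_ge (Nat.le_nth_of_lt_nth_succ hc ha)

lemma nth_prime_eight : Nat.nth Nat.Prime 8 = 23 := by
  have h : Nat.count Nat.Prime 23 = 8 := by decide
  rw [← h]
  exact Nat.nth_count (by norm_num)

lemma nth_prime_cube_lt {k : ℕ} (hk : 8 ≤ k) :
    Nat.nth Nat.Prime (k + 2) ^ 3 < Nat.nth Nat.Prime (k + 1) ^ 3 + Nat.nth Nat.Prime k ^ 3 := by
  have hmono := Nat.nth_strictMono Nat.infinite_setOfPred_prime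
  have h23 : 23 ≤ Nat.nth Nat.Prime k := nth_prime_eight ▸ hmono.monotone hk
  have hpq : Nat.nth Nat.Prime k < Nat.nth Nat.Prime (k + 1) := hmono (Nat.lt_succ_self k)
  have hp := Nat.prime_nth_prime k
  have hq := Nat.prime_nth_prime (k + 1)
  have hqle : ∀ a, a.Prime → Nat.nth Nat.Prime k < a → Nat.nth Nat.Prime (k + 1) ≤ a :=
    fun a => nth_prime_succ_le
  have hrle : ∀ a, a.Prime → Nat.nth Nat.Prime (k + 1) < a → Nat.nth Nat.Prime (k + 2) ≤ a :=
    fun a => nth_prime_succ_le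
  generalize Nat.nth Nat.Prime k = p at *
  generalize Nat.nth Nat.Prime (k + 1) = q at *
  generalize Nat.nth Nat.Prime (k + 2) = r at *
  rcases lt_or_ge p 37 with hp37 | hp37
  -- Here r³ < 2p³ fails, so the actual value of q is needed.
  · have hsmall : p = 23 ∧ q = 29 ∨ p = 29 ∧ q = 31 ∨ p = 31 ∧ q = 37 := by
      have hp' : p = 23 ∨ p = 29 ∨ p = 31 := by
        interval_cases p <;> first | omega | (exfalso; revert hp; norm_num)
      rcases hp' with rfl | rfl | rfl
      · have := hqle 29 (by norm_num) (by norm_num)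
        interval_cases q <;> first | omega | (exfalso; revert hq; norm_num)
      · have := hqle 31 (by norm_num) (by norm_num)
        interval_cases q <;> first | omega | (exfalso; revert hq; norm_num)
      · have := hqle 37 (by norm_num) (by norm_num)
        interval_cases q <;> first | omega | (exfalso; revert hq; norm_num)
    rcases hsmall with ⟨rfl, rfl⟩ | ⟨rfl, rfl⟩ | ⟨rfl, rfl⟩
    · exact (Nat.pow_le_pow_left (hrle 31 (by norm_num) (by norm_num)) 3).trans_lt (by norm_num)
    · exact (Nat.pow_le_pow_left (hrle 37 (by norm_num) (by norm_num)) 3).trans_lt (by norm_num)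
    · exact (Nat.pow_le_pow_left (hrle 41 (by norm_num) (by norm_num)) 3).trans_lt (by norm_num)
  · obtain ⟨a, b, ha, hb, hpa, hab, hb3⟩ := primePairAbove_of_ge p hp37
    have hqa := hqle a ha hpa
    have hrb := hrle b hb (hqa.trans_lt hab)
    have h1 : r ^ 3 ≤ b ^ 3 := Nat.pow_le_pow_left hrb 3
    have h2 : p ^ 3 < q ^ 3 := Nat.pow_lt_pow_left hpq (by norm_num)
    omega

theorem theorem3 (n : ℕ) (hn : 9 ≤ n) :
    nthPrime (n + 2) ^ 3 < nthPrime (n + 1) ^ 3 + nthPrime n ^ 3 := by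
  obtain ⟨k, rfl⟩ : ∃ k, n = k + 1 := ⟨n - 1, by omega⟩
  exact nth_prime_cube_lt (k := k) (by omega)
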